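/- Let $d\ge 1$ and let $X=(x_1,\dots,x_{d+2})=\bigl(e_1,\dots,e_d,\,0,\,\tfrac1{d+1}\sum_{i=1}^d e_i\bigr)$ be a configuration of $d+2$ points in $\mathbb{R}^d$, with convex hull $P$. Let $w=(w_1,\dots,w_{d+2})$ be positive weights with $\sum_i w_i=1$ and $w_1=w_2=\cdots=w_{d+1}$. For $y\in\mathbb{R}^{d+2}$ and $t\in P$ let $h_{X,y}(t)$ be the largest $s$ such that $(t,s)$ lies in the convex hull of $(x_1,y_1),\dots,(x_{d+2},y_{d+2})$, and let $f_{X,y}=\exp(h_{X,y})$ on $P$ and $f_{X,y}=0$ outside $P$. There is a unique $y^*\in\mathbb{R}^{d+2}$ such that $h_{X,y^*}(x_i)=y^*_i$ for all $i$ and $f_{X,y^*}$ maximizes $\sum_i w_i\log f(x_i)$ over all integrable $f:\mathbb{R}^d\to\mathbb{R}_{\ge0}$ with $\log f$ concave (with values in $\mathbb{R}\cup\{-\infty\}$) and $\int_{\mathbb{R}^d} f(t)\,dt=1$. The optimal subdivision of $(X,w)$ is the regular subdivision of $X$ induced by $y^*$: its cells are the sets $\{i : x_i\in R\}$, where $R$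 runs over the ($d$-dimensional) regions of linearity of $h_{X,y^*}$. Then, with $\mathcal{D}=\{1,\dots,d+2\}$, the optimal subdivision of $(X,w)$ is the triangulation $\{\mathcal{D}\setminus\{1\},\,\mathcal{D}\setminus\{2\},\dots,\mathcal{D}\setminus\{d+1\}\}$ if and only if $\dfrac{w_{d+2}}{w_1}>\dfrac{d+1}{d}$. -/

import Mathlib

open MeasureTheory

namespace LogConcaveMLE

noncomputable section

/-- `f` is a log-concave probability density on `ℝᵈ` (with Lebesgue measure): nonnegative, integrable,
of integral one, with `log f : ℝᵈ → ℝ ∪ {-∞}` concave.  As `log f = -∞` exactly where `f` vanishes,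
concavity means that `{f > 0}` is convex and `log f` is concave on it
(`ConcaveOn` contains both assertions). -/
structure IsLogConcaveDensity {d : ℕ} (f : (Fin d → ℝ) → ℝ) : Prop where
  nonneg : ∀ t, 0 ≤ f t
  logConcave : ConcaveOn ℝ {t | 0 < f t} (fun t => Real.log (f t))
  integrable : Integrable f volume
  integral_eq_one : ∫ t, f t = 1

/-- The log-likelihood `∑ᵢ wᵢ log f(xᵢ)` of the sample `(X, w)`, with `log 0 = -∞`. -/
def logLikelihood {d : ℕ} {ι : Type*} [Fintype ι] (X : ι → Fin d → ℝ) (w : ι → ℝ)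
    (f : (Fin d → ℝ) → ℝ) : EReal :=
  ∑ i, (w i : EReal) * ENNReal.log (ENNReal.ofReal (f (X i)))

/-- `f` is an optimal solution of the estimation problem for `(X, w)`: it maximizes the
log-likelihood over all log-concave densities. -/
def IsMLE {d : ℕ} {ι : Type*} [Fintype ι] (X : ι → Fin d → ℝ) (w : ι → ℝ)
    (f : (Fin d → ℝ) → ℝ) : Prop :=
  IsLogConcaveDensity f ∧
    ∀ g, IsLogConcaveDensity g → logLikelihood X w g ≤ logLikelihood X w f

/-- The polytope `P = conv(X)`. -/
def polytope {d : ℕ} {ι : Type*} (X : ι → Fin d → ℝ) : Set (Fin d → ℝ) :=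
  convexHull ℝ (Set.range X)

/-- The tent function `h_{X,y}` on `P`: the largest real number `s` such that `(t, s)` lies in the
convex hull of the lifted points `(xᵢ, yᵢ)`.  Outside `P` the tent function is `-∞`; the real-valued
function below is only ever used at points of `P`. -/
def tent {d : ℕ} {ι : Type*} (X : ι → Fin d → ℝ) (y : ι → ℝ) (t : Fin d → ℝ) : ℝ :=
  sSup {s : ℝ | (t, s) ∈ convexHull ℝ (Set.range fun i => (X i, y i))}

/-- The heights `y` are relevant: every `(xᵢ, yᵢ)` is a tent pole. -/
def IsRelevant {d : ℕ} {ι : Type*} (X : ι → Fin d → ℝ) (y : ι → ℝ) : Prop :=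
  ∀ i, tent X y (X i) = y i

open Classical in
/-- The function `f_{X,y}`, equal to `exp h_{X,y}` on `P` and to `0` outside `P`. -/
def tentDensity {d : ℕ} {ι : Type*} (X : ι → Fin d → ℝ) (y : ι → ℝ) (t : Fin d → ℝ) : ℝ :=
  if t ∈ polytope X then Real.exp (tent X y t) else 0

/-- `R` is a (`d`-dimensional) region of linearity of the tent function `h_{X,y}`: the set of all
points of `P` where `h_{X,y}` agrees with some affine function, if this set is full-dimensional. -/
def IsRegionOfLinearity {d : ℕ} {ι : Type*} (X : ι → Fin d → ℝ) (y : ι → ℝ)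
    (R : Set (Fin d → ℝ)) : Prop :=
  ∃ l : (Fin d → ℝ) →ᵃ[ℝ] ℝ,
    R = {t | t ∈ polytope X ∧ tent X y t = l t} ∧ (interior R).Nonempty

/-- The regular subdivision of `X` induced by the heights `y`: its cells are the sets of labels of
the tent poles over the regions of linearity of `h_{X,y}`. -/
def regularSubdivision {d : ℕ} {ι : Type*} (X : ι → Fin d → ℝ) (y : ι → ℝ) : Set (Set ι) :=
  {σ | ∃ R, IsRegionOfLinearity X y R ∧ σ = {i | X i ∈ R ∧ tent X y (X i) = y i}}

/-- `y` is the vector of optimal heights for `(X, w)`: it is relevant and `f_{X,y}` is an optimal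
solution of the estimation problem. -/
def IsOptimalHeights {d : ℕ} {ι : Type*} [Fintype ι] (X : ι → Fin d → ℝ) (w : ι → ℝ)
    (y : ι → ℝ) : Prop :=
  IsRelevant X y ∧ IsMLE X w (tentDensity X y)

/-- `Δ` is the optimal subdivision for `(X, w)`: the one induced by the optimal heights. -/
def IsOptimalSubdivision {d : ℕ} {ι : Type*} [Fintype ι] (X : ι → Fin d → ℝ) (w : ι → ℝ)
    (Δ : Set (Set ι)) : Prop :=
  ∃ y, IsOptimalHeights X w y ∧ regularSubdivision X y = Δ

/-- The configuration `(e₁, …, e_d, 0, (1/(d+1)) ∑ eᵢ)` of `d + 2` points in `ℝᵈ`. -/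
def specialConfig (d : ℕ) : Fin (d + 2) → Fin d → ℝ :=
  Fin.snoc (α := fun _ => Fin d → ℝ)
    (Fin.snoc (α := fun _ => Fin d → ℝ) (fun i : Fin d => Pi.single i 1) 0)
    ((1 / ((d : ℝ) + 1)) • ∑ i : Fin d, Pi.single i 1)

/-- The triangulation `{𝒟 \ {1}, …, 𝒟 \ {d+1}}` of `𝒟 = {1, …, d+2}`: all its simplices have the
last, interior point as a vertex. -/
def interiorTriangulation (d : ℕ) : Set (Set (Fin (d + 2))) :=
  Set.range fun i : Fin (d + 1) => ({i.castSucc}ᶜ : Set (Fin (d + 2)))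

end

end LogConcaveMLE

open MeasureTheory

namespace LogConcaveMLE

noncomputable section

/-! The problem is symmetric in the vertices of the simplex, so the optimal log-density should have
the form `u + s * hat` with `s ≥ 0`. Its graph is flat for `s = 0` and, for `s > 0`, breaks exactly
along the cones from the barycenter over the facets (`regularSubdivision_symmHeights`). Everything
thus reduces to deciding when `s > 0`.

Write `b` for the weight of the barycenter and `p` for the mean of `hat` under `exp (u + s * hat)`.
The Kuhn-Tucker conditions for heights constrained to be concave read: total mass one, `b ≤ p`, `s *
(p - b) = 0`. At `s = 0` the density is uniform and `p = 1 / (d + 1)`, the volume of a pyramid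
(`setIntegral_hat`). If `b` does not exceed this value, `s = 0` works; otherwise the intermediate
value theorem gives `s > 0` with `p = b` (`exists_optimal_parameters`). Since the weights sum to
one, `b > 1 / (d + 1)` is the stated bound on the ratio of weights.

These conditions are sufficient (`symmHeights_maximal`). For heights `z`, both the log-likelihood
and the mean of `interp z` under the candidate equal the vertex mean plus a multiple of the
elevation of the barycenter above it; the multiples are `b` and `p`. Integrating `x + 1 ≤ exp x`
bounds the mean, and `b ≤ p` transfers the bound to the log-likelihood. Strictness of the
exponential inequality gives uniqueness. An arbitrary log-concave density reduces to heights because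
its logarithm dominates the interpolant of its values at the sample points
(`exp_interp_le_of_isLogConcaveDensity`). -/

/-! ### Barycentric coordinates on the standard simplex -/

/-- The vertices `e₁, …, e_d, 0` of the standard simplex. -/
def vertex (d : ℕ) : Fin (d + 1) → Fin d → ℝ :=
  Fin.snoc (α := fun _ => Fin d → ℝ) (fun i : Fin d => Pi.single i 1) 0

/-- The barycenter of the standard simplex. -/
def center (d : ℕ) : Fin d → ℝ :=
  (1 / ((d : ℝ) + 1)) • ∑ i : Fin d, Pi.single i 1

/-- The barycentric coordinates with respect to `vertex d`. -/
def bary {d : ℕ} (i : Fin (d + 1)) : (Fin d → ℝ) →ᵃ[ℝ] ℝ :=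
  Fin.snoc (α := fun _ => (Fin d → ℝ) →ᵃ[ℝ] ℝ)
    (fun j : Fin d => (LinearMap.proj j : (Fin d → ℝ) →ₗ[ℝ] ℝ).toAffineMap)
    (AffineMap.const ℝ (Fin d → ℝ) 1 -
      (∑ j : Fin d, (LinearMap.proj j : (Fin d → ℝ) →ₗ[ℝ] ℝ)).toAffineMap) i

/-- The simplex `conv(e₁, …, e_d, 0)`. -/
def simplex (d : ℕ) : Set (Fin d → ℝ) := {t | ∀ i : Fin (d + 1), 0 ≤ bary i t}

/-- The concave piecewise linear function that is `1` at the barycenter and `0` at the vertices. -/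
def hat {d : ℕ} (t : Fin d → ℝ) : ℝ :=
  ((d : ℝ) + 1) * Finset.univ.inf' Finset.univ_nonempty (fun i : Fin (d + 1) => bary i t)

/-- The mean of the heights over the vertices of the simplex. -/
def vertexMean {d : ℕ} (y : Fin (d + 2) → ℝ) : ℝ :=
  (∑ i : Fin (d + 1), y i.castSucc) / ((d : ℝ) + 1)

/-- The function that interpolates the heights `y` and is linear on each cone over a facet with
apex the barycenter. -/
def interp {d : ℕ} (y : Fin (d + 2) → ℝ) (t : Fin d → ℝ) : ℝ :=
  ∑ i : Fin (d + 1), bary i t * y i.castSucc + hat t * (y (Fin.last (d + 1)) - vertexMean y)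

variable {d : ℕ}

@[simp] lemma bary_castSucc (i : Fin d) (t : Fin d → ℝ) : bary i.castSucc t = t i := by
  simp [bary]

@[simp] lemma bary_last (t : Fin d → ℝ) : bary (Fin.last d) t = 1 - ∑ j, t j := by
  simp [bary]

lemma sum_bary (t : Fin d → ℝ) : ∑ i, bary i t = 1 := by
  simp [Fin.sum_univ_castSucc]

@[simp] lemma vertex_castSucc (i : Fin d) : vertex d i.castSucc = Pi.single i 1 := by
  simp [vertex]

@[simp] lemma vertex_last : vertex d (Fin.last d) = 0 := by simp [vertex]

lemma sum_bary_smul_vertex (t : Fin d → ℝ) : ∑ i, bary i t • vertex d i = t := by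
  ext j
  simp [Fin.sum_univ_castSucc, Finset.sum_apply, Pi.single_apply]

lemma bary_vertex (i j : Fin (d + 1)) : bary i (vertex d j) = if i = j then 1 else 0 := by
  refine Fin.lastCases ?_ (fun i => ?_) i <;> refine Fin.lastCases ?_ (fun j => ?_) j <;>
    simp [Pi.single_apply, Fin.castSucc_ne_last, (Fin.castSucc_ne_last _).symm]

lemma succ_cast_pos (d : ℕ) : (0 : ℝ) < (d : ℝ) + 1 := by positivity

@[simp] lemma bary_center (i : Fin (d + 1)) : bary i (center d) = 1 / ((d : ℝ) + 1) := by
  have := succ_cast_pos d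
  refine Fin.lastCases ?_ (fun i => ?_) i
  · simp [center, Finset.sum_apply, Pi.single_apply]
    field_simp
    ring
  · simp [center, Finset.sum_apply, Pi.single_apply]

lemma specialConfig_castSucc (i : Fin (d + 1)) : specialConfig d i.castSucc = vertex d i := by
  simp [specialConfig, vertex]

lemma specialConfig_last : specialConfig d (Fin.last (d + 1)) = center d := by
  simp [specialConfig, center]

lemma center_eq_sum : center d = ∑ i, (1 / ((d : ℝ) + 1)) • vertex d i := by
  conv_lhs => rw [← sum_bary_smul_vertex (center d)]
  simp

/-! ### The hat function -/

lemma hat_le (t : Fin d → ℝ) (i : Fin (d + 1)) : hat t ≤ ((d : ℝ) + 1) * bary i t :=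
  mul_le_mul_of_nonneg_left (Finset.inf'_le _ (Finset.mem_univ i)) (succ_cast_pos d).le

lemma exists_hat_eq (t : Fin d → ℝ) : ∃ i, hat t = ((d : ℝ) + 1) * bary i t := by
  obtain ⟨i, -, hi⟩ := Finset.exists_mem_eq_inf' (s := Finset.univ) Finset.univ_nonempty
    (fun i : Fin (d + 1) => bary i t)
  exact ⟨i, by rw [hat, hi]⟩

lemma le_hat_iff {r : ℝ} {t : Fin d → ℝ} : r ≤ hat t ↔ ∀ i, r ≤ ((d : ℝ) + 1) * bary i t := by
  refine ⟨fun h i => h.trans (hat_le t i), fun h => ?_⟩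
  obtain ⟨i, hi⟩ := exists_hat_eq t
  exact hi ▸ h i

lemma mem_simplex_iff {t : Fin d → ℝ} : t ∈ simplex d ↔ 0 ≤ hat t := by
  rw [le_hat_iff]
  exact forall_congr' fun i => (mul_nonneg_iff_of_pos_left (succ_cast_pos d)).symm

lemma hat_le_one (t : Fin d → ℝ) : hat t ≤ 1 := by
  have h : ∑ i : Fin (d + 1), hat t ≤ ∑ i : Fin (d + 1), ((d : ℝ) + 1) * bary i t :=
    Finset.sum_le_sum fun i _ => hat_le t i
  rw [← Finset.mul_sum, sum_bary] at h
  simp only [Finset.sum_const, Finset.card_univ, Fintype.card_fin, nsmul_eq_mul, Nat.cast_add,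
    Nat.cast_one] at h
  exact le_of_mul_le_mul_left h (succ_cast_pos d)

lemma hat_eq_of_forall {t : Fin d → ℝ} (i : Fin (d + 1)) (h : ∀ j, bary i t ≤ bary j t) :
    hat t = ((d : ℝ) + 1) * bary i t :=
  le_antisymm (hat_le t i) (le_hat_iff.2 fun j =>
    mul_le_mul_of_nonneg_left (h j) (succ_cast_pos d).le)

@[simp] lemma hat_center : hat (center d) = 1 := by
  rw [hat_eq_of_forall 0 (by simp), bary_center, mul_one_div_cancel (succ_cast_pos d).ne']

/-- For `d ≥ 1` some other coordinate vanishes at the vertex; for `d = 0` the vertex is the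
barycenter, where `hat` is `1`. -/
lemma hat_vertex (hd : 1 ≤ d) (j : Fin (d + 1)) : hat (vertex d j) = 0 := by
  have : Nontrivial (Fin (d + 1)) := Fin.nontrivial_iff_two_le.2 (by omega)
  obtain ⟨i, hi⟩ := exists_ne j
  rw [hat_eq_of_forall i, bary_vertex, if_neg hi, mul_zero]
  intro k
  rw [bary_vertex, bary_vertex, if_neg hi]
  split_ifs <;> norm_num

@[fun_prop] lemma continuous_bary (i : Fin (d + 1)) : Continuous (bary i : (Fin d → ℝ) → ℝ) :=
  (bary i).continuous_of_finiteDimensional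

@[fun_prop] lemma continuous_hat : Continuous (hat : (Fin d → ℝ) → ℝ) :=
  continuous_const.mul
    (Continuous.finset_inf'_apply Finset.univ_nonempty fun i _ => continuous_bary i)

lemma bary_combo (i : Fin (d + 1)) (a b : ℝ) (hab : a + b = 1) (s t : Fin d → ℝ) :
    bary i (a • s + b • t) = a * bary i s + b * bary i t := by
  simpa using Convex.combo_affine_apply (f := (bary i : (Fin d → ℝ) →ᵃ[ℝ] ℝ)) hab (x := s) (y := t)

lemma concaveOn_hat : ConcaveOn ℝ Set.univ (hat : (Fin d → ℝ) → ℝ) := by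
  refine ⟨convex_univ, fun s _ t _ a b ha hb hab => ?_⟩
  rw [le_hat_iff]
  intro i
  rw [bary_combo i a b hab]
  have h1 := mul_le_mul_of_nonneg_left (hat_le s i) ha
  have h2 := mul_le_mul_of_nonneg_left (hat_le t i) hb
  simp only [smul_eq_mul]
  linarith

/-- On rays from the barycenter the hat function is affine. -/
lemma hat_homothety {k : ℝ} (hk : 0 ≤ k) (t : Fin d → ℝ) :
    hat (AffineMap.homothety (center d) k t) = 1 - k * (1 - hat t) := by
  have hb : ∀ i : Fin (d + 1), ((d : ℝ) + 1) * bary i (AffineMap.homothety (center d) k t) =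
      1 - k + k * (((d : ℝ) + 1) * bary i t) := by
    intro i
    have : AffineMap.homothety (center d) k t = (1 - k) • center d + k • t := by
      ext j; simp [AffineMap.homothety_apply]; ring
    rw [this, bary_combo i _ _ (by ring), bary_center]
    field_simp [(succ_cast_pos d).ne']
  obtain ⟨i, hi⟩ := exists_hat_eq t
  rw [hat_eq_of_forall i, hb, ← hi]
  · ring
  · intro j
    refine le_of_mul_le_mul_left ?_ (succ_cast_pos d)
    rw [hb, hb, ← hi]
    have := mul_le_mul_of_nonneg_left (hat_le t j) hk
    linarith

/-- Along rays from the barycenter `1 - hat` scales linearly, so superlevel sets are shrunken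
simplices, whose volumes are known up to that of the simplex. -/
lemma setOf_le_hat {r : ℝ} (hr : r < 1) :
    {t : Fin d → ℝ | r ≤ hat t} = AffineMap.homothety (center d) (1 - r) '' simplex d := by
  have h1 : 0 < 1 - r := by linarith
  ext t
  constructor
  · intro ht
    refine ⟨AffineMap.homothety (center d) (1 - r)⁻¹ t, ?_, ?_⟩
    · rw [mem_simplex_iff, hat_homothety (by positivity)]
      have : (1 - r)⁻¹ * (1 - hat t) ≤ (1 - r)⁻¹ * (1 - r) := by
        refine mul_le_mul_of_nonneg_left ?_ (by positivity)
        have : r ≤ hat t := ht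
        linarith
      rw [inv_mul_cancel₀ h1.ne'] at this
      linarith
    · rw [← AffineMap.homothety_mul_apply, mul_inv_cancel₀ h1.ne', AffineMap.homothety_one]
      rfl
  · rintro ⟨s, hs, rfl⟩
    rw [mem_simplex_iff] at hs
    rw [Set.mem_ofPred_eq, hat_homothety h1.le]
    nlinarith [mul_nonneg h1.le hs]

/-! ### Topology of the simplex -/

lemma isClosed_simplex : IsClosed (simplex d) := by
  have : simplex d = {t | 0 ≤ hat t} := by ext t; exact mem_simplex_iff
  rw [this]
  exact isClosed_le continuous_const continuous_hat

lemma convex_simplex : Convex ℝ (simplex d) := by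
  intro s hs t ht a b ha hb hab i
  rw [bary_combo i a b hab]
  exact add_nonneg (mul_nonneg ha (hs i)) (mul_nonneg hb (ht i))

lemma bary_le_one {t : Fin d → ℝ} (ht : t ∈ simplex d) (i : Fin (d + 1)) : bary i t ≤ 1 := by
  rw [← sum_bary t]
  exact Finset.single_le_sum (fun j _ => ht j) (Finset.mem_univ i)

lemma isCompact_simplex : IsCompact (simplex d) := by
  refine (isCompact_Icc (a := (0 : Fin d → ℝ)) (b := 1)).of_isClosed_subset isClosed_simplex ?_
  intro t ht
  constructor <;> intro i
  · simpa using ht i.castSucc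
  · simpa using bary_le_one ht i.castSucc

lemma measurableSet_simplex : MeasurableSet (simplex d) := isClosed_simplex.measurableSet

lemma center_mem_interior : center d ∈ interior (simplex d) := by
  refine mem_interior.2 ⟨{t | 0 < hat t}, fun t ht => mem_simplex_iff.2 (le_of_lt ht),
    isOpen_lt continuous_const continuous_hat, ?_⟩
  simp

lemma simplex_subset_closure_interior : simplex d ⊆ closure (interior (simplex d)) := by
  rw [convex_simplex.closure_interior_eq_closure_of_nonempty_interior ⟨_, center_mem_interior⟩]
  exact subset_closure

lemma vertex_mem_simplex (i : Fin (d + 1)) : vertex d i ∈ simplex d := by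
  intro j
  rw [bary_vertex]
  split_ifs <;> norm_num

lemma center_mem_simplex : center d ∈ simplex d := interior_subset center_mem_interior

lemma specialConfig_mem_simplex (k : Fin (d + 2)) : specialConfig d k ∈ simplex d := by
  refine Fin.lastCases ?_ (fun i => ?_) k
  · rw [specialConfig_last]; exact center_mem_simplex
  · rw [specialConfig_castSucc]; exact vertex_mem_simplex i

lemma polytope_specialConfig : polytope (specialConfig d) = simplex d := by
  refine subset_antisymm (convexHull_min ?_ convex_simplex) ?_
  · rintro _ ⟨k, rfl⟩
    exact specialConfig_mem_simplex k
  · intro t ht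
    rw [← sum_bary_smul_vertex t]
    refine (convex_convexHull ℝ _).sum_mem (fun i _ => ht i) (sum_bary t) fun i _ => ?_
    rw [← specialConfig_castSucc]
    exact subset_convexHull ℝ _ ⟨_, rfl⟩

/-! ### Interpolation on the subdivided simplex and the tent function -/

/-- The coordinates of a point with respect to the simplex of the interior triangulation that
contains it. -/
def coneCoord (t : Fin d → ℝ) : Fin (d + 2) → ℝ :=
  Fin.snoc (α := fun _ => ℝ) (fun i : Fin (d + 1) => bary i t - hat t / ((d : ℝ) + 1)) (hat t)

@[simp] lemma coneCoord_castSucc (t : Fin d → ℝ) (i : Fin (d + 1)) :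
    coneCoord t i.castSucc = bary i t - hat t / ((d : ℝ) + 1) := by simp [coneCoord]

@[simp] lemma coneCoord_last (t : Fin d → ℝ) : coneCoord t (Fin.last (d + 1)) = hat t := by
  simp [coneCoord]

lemma coneCoord_nonneg {t : Fin d → ℝ} (ht : t ∈ simplex d) (k : Fin (d + 2)) :
    0 ≤ coneCoord t k := by
  refine Fin.lastCases ?_ (fun i => ?_) k
  · simpa using mem_simplex_iff.1 ht
  · rw [coneCoord_castSucc, sub_nonneg, div_le_iff₀' (succ_cast_pos d)]
    exact hat_le t i

lemma sum_coneCoord (t : Fin d → ℝ) : ∑ k, coneCoord t k = 1 := by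
  have := (succ_cast_pos d).ne'
  simp [Fin.sum_univ_castSucc (n := d + 1), Finset.sum_sub_distrib, sum_bary]
  field_simp
  ring

lemma sum_coneCoord_smul (t : Fin d → ℝ) : ∑ k, coneCoord t k • specialConfig d k = t := by
  simp only [Fin.sum_univ_castSucc (n := d + 1), specialConfig_castSucc, specialConfig_last,
    coneCoord_castSucc, coneCoord_last, sub_smul, Finset.sum_sub_distrib, sum_bary_smul_vertex]
  rw [center_eq_sum, Finset.smul_sum]
  simp [smul_smul, div_eq_mul_inv]

lemma sum_coneCoord_mul (y : Fin (d + 2) → ℝ) (t : Fin d → ℝ) :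
    ∑ k, coneCoord t k * y k = interp y t := by
  simp only [Fin.sum_univ_castSucc (n := d + 1), coneCoord_castSucc, coneCoord_last, sub_mul,
    Finset.sum_sub_distrib, ← Finset.mul_sum, interp, vertexMean]
  ring

lemma interp_specialConfig (hd : 1 ≤ d) (y : Fin (d + 2) → ℝ) (k : Fin (d + 2)) :
    interp y (specialConfig d k) = y k := by
  refine Fin.lastCases ?_ (fun i => ?_) k
  · rw [specialConfig_last, interp]
    simp [← Finset.mul_sum, vertexMean]
    ring
  · rw [specialConfig_castSucc, interp, hat_vertex hd]
    simp [bary_vertex]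

@[fun_prop] lemma continuous_interp (y : Fin (d + 2) → ℝ) : Continuous (interp y) := by
  unfold interp
  exact (continuous_finsetSum _ fun i _ => (continuous_bary i).mul continuous_const).add
    (continuous_hat.mul continuous_const)

lemma concaveOn_interp {y : Fin (d + 2) → ℝ} (hy : vertexMean y ≤ y (Fin.last (d + 1))) :
    ConcaveOn ℝ Set.univ (interp y) := by
  refine ⟨convex_univ, fun s _ t _ a b ha hb hab => ?_⟩
  have h := mul_le_mul_of_nonneg_right (concaveOn_hat.2 (Set.mem_univ s) (Set.mem_univ t) ha hb hab)
    (sub_nonneg.2 hy)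
  simp only [interp, smul_eq_mul, bary_combo _ a b hab, add_mul, Finset.sum_add_distrib, mul_assoc,
    ← Finset.mul_sum] at h ⊢
  linarith

/-- The cone coordinates exhibit the value as a convex combination of lifted points. It is maximal
because the hypograph of a concave interpolant is convex and contains all lifted points. -/
lemma isGreatest_tent (hd : 1 ≤ d) {y : Fin (d + 2) → ℝ}
    (hy : vertexMean y ≤ y (Fin.last (d + 1))) {t : Fin d → ℝ} (ht : t ∈ simplex d) :
    IsGreatest {s : ℝ | (t, s) ∈ convexHull ℝ (Set.range fun k => (specialConfig d k, y k))}
      (interp y t) := by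
  constructor
  · have h : ((t, interp y t) : (Fin d → ℝ) × ℝ) =
        ∑ k, coneCoord t k • (specialConfig d k, y k) := by
      refine Prod.ext ?_ ?_
      · simp [Prod.fst_sum, sum_coneCoord_smul]
      · simp [Prod.snd_sum, sum_coneCoord_mul]
    rw [Set.mem_ofPred_eq, h]
    exact (convex_convexHull ℝ _).sum_mem (fun k _ => coneCoord_nonneg ht k) (sum_coneCoord t)
      fun k _ => subset_convexHull ℝ _ ⟨k, rfl⟩
  · intro s hs
    have hsub : convexHull ℝ (Set.range fun k => (specialConfig d k, y k)) ⊆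
        {p : (Fin d → ℝ) × ℝ | p.1 ∈ Set.univ ∧ p.2 ≤ interp y p.1} := by
      refine convexHull_min ?_ (concaveOn_interp hy).convex_hypograph
      rintro _ ⟨k, rfl⟩
      exact ⟨Set.mem_univ _, (interp_specialConfig hd y k).ge⟩
    exact (hsub hs).2

lemma tent_eq_interp (hd : 1 ≤ d) {y : Fin (d + 2) → ℝ}
    (hy : vertexMean y ≤ y (Fin.last (d + 1))) {t : Fin d → ℝ} (ht : t ∈ simplex d) :
    tent (specialConfig d) y t = interp y t :=
  (isGreatest_tent hd hy ht).csSup_eq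

/-- The only obstruction to relevance is at the barycenter: the average of the lifted vertices lies
over it at height `vertexMean y`. -/
lemma isRelevant_iff (hd : 1 ≤ d) {y : Fin (d + 2) → ℝ} :
    IsRelevant (specialConfig d) y ↔ vertexMean y ≤ y (Fin.last (d + 1)) := by
  refine ⟨fun h => ?_, fun hy k => ?_⟩
  · rw [← h (Fin.last (d + 1)), tent]
    refine le_csSup ?_ ?_
    · obtain ⟨M, hM⟩ := (Set.finite_range y).bddAbove
      refine ⟨M, fun s hs => ?_⟩
      have hsub : convexHull ℝ (Set.range fun k => (specialConfig d k, y k)) ⊆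
          {p : (Fin d → ℝ) × ℝ | p.2 ≤ M} := by
        refine convexHull_min ?_ (convex_halfSpace_le (LinearMap.snd ℝ _ _).isLinear M)
        rintro _ ⟨k, rfl⟩
        exact hM ⟨k, rfl⟩
      exact hsub hs
    · have he : ((specialConfig d (Fin.last (d + 1)), vertexMean y) : (Fin d → ℝ) × ℝ) =
          ∑ i : Fin (d + 1), (1 / ((d : ℝ) + 1)) •
            (specialConfig d i.castSucc, y i.castSucc) := by
        refine Prod.ext ?_ ?_
        · simp [Prod.fst_sum, specialConfig_last, specialConfig_castSucc, center_eq_sum]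
        · simp only [Prod.snd_sum, Prod.smul_snd, smul_eq_mul, ← Finset.mul_sum, vertexMean]
          ring
      rw [Set.mem_ofPred_eq, he]
      refine (convex_convexHull ℝ _).sum_mem (fun i _ => (one_div_pos.2 (succ_cast_pos d)).le) ?_
        fun i _ => subset_convexHull ℝ _ ⟨i.castSucc, rfl⟩
      simp [(succ_cast_pos d).ne']
  · rw [tent_eq_interp hd hy (specialConfig_mem_simplex k), interp_specialConfig hd]

lemma tentDensity_eq_indicator (hd : 1 ≤ d) {y : Fin (d + 2) → ℝ}
    (hy : vertexMean y ≤ y (Fin.last (d + 1))) :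
    tentDensity (specialConfig d) y =
      (simplex d).indicator fun t => Real.exp (interp y t) := by
  ext t
  by_cases ht : t ∈ simplex d
  · simp [tentDensity, polytope_specialConfig, ht, tent_eq_interp hd hy ht]
  · simp [tentDensity, polytope_specialConfig, ht]

/-! ### Integration over the simplex -/

lemma integrableOn_simplex {f : (Fin d → ℝ) → ℝ} (hf : Continuous f) :
    IntegrableOn f (simplex d) volume :=
  hf.continuousOn.integrableOn_compact isCompact_simplex

/-- The simplex lies in the closure of its interior, so vanishing almost everywhere extends by
continuity to the boundary, in particular to the vertices. -/
lemma eqOn_zero_of_setIntegral_eq_zero {f : (Fin d → ℝ) → ℝ} (hf : Continuous f)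
    (hnn : ∀ t ∈ simplex d, 0 ≤ f t) (h : ∫ t in simplex d, f t = 0) :
    Set.EqOn f 0 (simplex d) := by
  have hae : f =ᵐ[volume.restrict (simplex d)] 0 :=
    (setIntegral_eq_zero_iff_of_nonneg_ae
      ((ae_restrict_mem measurableSet_simplex).mono hnn) (integrableOn_simplex hf)).1 h
  exact Measure.eqOn_of_ae_eq hae hf.continuousOn continuousOn_const
    simplex_subset_closure_interior

lemma setIntegral_simplex_pos {f : (Fin d → ℝ) → ℝ} (hf : Continuous f)
    (hnn : ∀ t ∈ simplex d, 0 ≤ f t) (hc : f (center d) ≠ 0) : 0 < ∫ t in simplex d, f t :=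
  (setIntegral_nonneg measurableSet_simplex hnn).lt_of_ne fun h =>
    hc (eqOn_zero_of_setIntegral_eq_zero hf hnn h.symm center_mem_simplex)

/-- Layer-cake formula: the superlevel set at `r` has volume `(1 - r) ^ d` times that of the
simplex. -/
lemma setIntegral_hat :
    ∫ t in simplex d, hat t = volume.real (simplex d) / ((d : ℝ) + 1) := by
  have hint := integrableOn_simplex (d := d) continuous_hat
  have hnn : 0 ≤ᵐ[volume.restrict (simplex d)] (hat : (Fin d → ℝ) → ℝ) :=
    (ae_restrict_mem measurableSet_simplex).mono fun t ht => mem_simplex_iff.1 ht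
  -- The endpoint `r = 1` is discarded because `setOf_le_hat` needs `r < 1`.
  rw [Integrable.integral_eq_integral_Ioc_meas_le hint hnn (.of_forall hat_le_one),
    integral_Ioc_eq_integral_Ioo]
  have hlevel : ∀ r ∈ Set.Ioo (0 : ℝ) 1,
      (volume.restrict (simplex d)).real {t | r ≤ hat t} =
        (1 - r) ^ d * volume.real (simplex d) := by
    intro r hr
    have hsub : {t : Fin d → ℝ | r ≤ hat t} ⊆ simplex d :=
      fun t ht => mem_simplex_iff.2 (hr.1.le.trans ht)
    rw [measureReal_restrict_apply' measurableSet_simplex, Set.inter_eq_left.2 hsub,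
      setOf_le_hat hr.2, Measure.real, Measure.addHaar_image_homothety, ENNReal.toReal_mul,
      ENNReal.toReal_ofReal (abs_nonneg _), Module.finrank_fin_fun,
      abs_of_nonneg (pow_nonneg (sub_nonneg.2 hr.2.le) d), Measure.real]
  rw [setIntegral_congr_fun measurableSet_Ioo hlevel, ← integral_Ioc_eq_integral_Ioo,
    ← intervalIntegral.integral_of_le zero_le_one, intervalIntegral.integral_mul_const,
    intervalIntegral.integral_comp_sub_left (fun x => x ^ d) 1]
  simp
  ring

/-- The linear part of `reflection`. -/
def reflectionLinear (i : Fin d) : (Fin d → ℝ) →ₗ[ℝ] Fin d → ℝ :=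
  LinearMap.id - (∑ j : Fin d, (LinearMap.proj j : (Fin d → ℝ) →ₗ[ℝ] ℝ) +
    LinearMap.proj i).smulRight (Pi.single i 1)

/-- The affine symmetry of the simplex exchanging `eᵢ` and `0`. -/
def reflection (i : Fin d) (t : Fin d → ℝ) : Fin d → ℝ :=
  reflectionLinear i t + Pi.single i 1

lemma reflectionLinear_apply (i : Fin d) (t : Fin d → ℝ) :
    reflectionLinear i t = t - (∑ j, t j + t i) • Pi.single i 1 := by
  simp [reflectionLinear]

lemma reflectionLinear_comp_self (i : Fin d) :
    reflectionLinear i ∘ₗ reflectionLinear i = LinearMap.id := by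
  refine LinearMap.ext fun t => ?_
  ext j
  simp [reflectionLinear_apply, Finset.sum_sub_distrib, ← Finset.mul_sum]
  ring

/-- The linear part is an involution, so its determinant is `1` or `-1`. -/
lemma measurePreserving_reflection (i : Fin d) :
    MeasurePreserving (reflection i) volume volume := by
  have hsq : LinearMap.det (reflectionLinear i) * LinearMap.det (reflectionLinear i) = 1 := by
    rw [← LinearMap.det_comp, reflectionLinear_comp_self, LinearMap.det_id]
  have hL : MeasurePreserving (reflectionLinear i) volume volume := by
    refine ⟨(reflectionLinear i).continuous_of_finiteDimensional.measurable, ?_⟩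
    rw [Real.map_linearMap_volume_pi_eq_smul_volume_pi (left_ne_zero_of_mul_eq_one hsq)]
    have habs : |(LinearMap.det (reflectionLinear i))⁻¹| = 1 := by
      rw [abs_inv]
      rcases mul_self_eq_one_iff.1 hsq with h | h <;> simp [h]
    simp [habs]
  exact (measurePreserving_add_right volume _).comp hL

lemma bary_reflection (i : Fin d) (t : Fin d → ℝ) (j : Fin (d + 1)) :
    bary j (reflection i t) = bary (Equiv.swap i.castSucc (Fin.last d) j) t := by
  refine Fin.lastCases ?_ (fun j => ?_) j
  · rw [Equiv.swap_apply_right]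
    simp [reflection, reflectionLinear_apply, Finset.sum_add_distrib, Finset.sum_sub_distrib,
      ← Finset.mul_sum]
  · by_cases hij : j = i
    · subst hij
      rw [Equiv.swap_apply_left]
      simp [reflection, reflectionLinear_apply]
      ring
    · rw [Equiv.swap_apply_of_ne_of_ne (by simpa using hij) (Fin.castSucc_ne_last j)]
      simp [reflection, reflectionLinear_apply, hij]

lemma reflection_involutive (i : Fin d) : Function.Involutive (reflection i) := by
  intro t
  rw [← sum_bary_smul_vertex (reflection i (reflection i t))]
  simp_rw [bary_reflection, Equiv.swap_apply_self]
  exact sum_bary_smul_vertex t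

lemma hat_reflection (i : Fin d) (t : Fin d → ℝ) : hat (reflection i t) = hat t := by
  have h : ∀ s, hat s ≤ hat (reflection i s) := fun s =>
    le_hat_iff.2 fun j => by rw [bary_reflection]; exact hat_le s _
  refine le_antisymm ?_ (h t)
  simpa [reflection_involutive i t] using h (reflection i t)

lemma setIntegral_bary_mul_eq_last (i : Fin (d + 1)) (φ : ℝ → ℝ) :
    ∫ t in simplex d, bary i t * φ (hat t) =
      ∫ t in simplex d, bary (Fin.last d) t * φ (hat t) := by
  refine Fin.lastCases rfl (fun i => ?_) i
  have hemb : MeasurableEmbedding (reflection i) :=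
    MeasurableEquiv.measurableEmbedding
      { toEquiv := (reflection_involutive i).toPerm
        measurable_toFun := (measurePreserving_reflection i).measurable
        measurable_invFun := (measurePreserving_reflection i).measurable }
  have hpre : reflection i ⁻¹' simplex d = simplex d := by
    ext t
    rw [Set.mem_preimage, mem_simplex_iff, mem_simplex_iff, hat_reflection]
  rw [← (measurePreserving_reflection i).setIntegral_preimage_emb hemb, hpre]
  refine setIntegral_congr_fun measurableSet_simplex fun t _ => ?_
  simp only [hat_reflection, bary_reflection, Equiv.swap_apply_left]

/-- A function of `hat` has its centroid at the barycenter. -/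
lemma setIntegral_bary_mul (i : Fin (d + 1)) {φ : ℝ → ℝ} (hφ : Continuous φ) :
    ∫ t in simplex d, bary i t * φ (hat t) =
      (∫ t in simplex d, φ (hat t)) / ((d : ℝ) + 1) := by
  have hsum : ∑ i : Fin (d + 1), ∫ t in simplex d, bary i t * φ (hat t) =
      ∫ t in simplex d, φ (hat t) := by
    rw [← integral_finsetSum]
    · simp [← Finset.sum_mul, sum_bary]
    · exact fun i _ => integrableOn_simplex (by fun_prop)
  rw [eq_div_iff (succ_cast_pos d).ne', ← hsum]
  simp_rw [setIntegral_bary_mul_eq_last _ φ]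
  simp
  ring

/-! ### The optimal parameters -/

lemma continuous_exp_hat (u s : ℝ) :
    Continuous fun t : Fin d → ℝ => Real.exp (u + s * hat t) :=
  Real.continuous_exp.comp (continuous_const.add (continuous_const.mul continuous_hat))

/-- A lower bound affine in `s`; after integration it forces the tilted moment in
`exists_tilt_of_lt` to become nonnegative at an explicit `s`. -/
lemma add_mul_max_sq_le (s y : ℝ) (hs : 0 ≤ s) :
    y + s * max y 0 ^ 2 ≤ y * Real.exp (s * y) := by
  rcases le_total 0 y with hy | hy
  · rw [max_eq_left hy]
    nlinarith [mul_le_mul_of_nonneg_left (Real.add_one_le_exp (s * y)) hy]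
  · rw [max_eq_right hy]
    have : Real.exp (s * y) ≤ 1 := Real.exp_le_one_iff.2 (mul_nonpos_of_nonneg_of_nonpos hs hy)
    nlinarith

/-- The integral vanishes exactly when `hat` has mean `b` under the density proportional to `exp (s
* hat)`. It is negative at `s = 0`, where the mean is `1 / (d + 1)`, and changes sign as `s` grows.
-/
lemma exists_tilt_of_lt {b : ℝ} (hb : b < 1) (hb' : 1 / ((d : ℝ) + 1) < b) :
    ∃ s : ℝ, 0 < s ∧ ∫ t : Fin d → ℝ in simplex d, (hat t - b) * Real.exp (s * (hat t - b)) = 0 := by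
  set F : ℝ → ℝ := fun s =>
    ∫ t : Fin d → ℝ in simplex d, (hat t - b) * Real.exp (s * (hat t - b)) with hF
  have hFc : Continuous F := by
    refine continuous_parametric_integral_of_continuous (μ := volume) ?_ isCompact_simplex
    have := continuous_hat (d := d)
    simp only [Function.uncurry_def]
    fun_prop
  have hsub : Continuous fun t : Fin d → ℝ => hat t - b := continuous_hat.sub continuous_const
  have hpos : Continuous fun t : Fin d → ℝ => max (hat t - b) 0 ^ 2 :=
    (hsub.max continuous_const).pow 2
  have hvol : 0 < volume.real (simplex d) := by
    have := setIntegral_simplex_pos (d := d) (f := fun _ => 1) continuous_const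
      (fun _ _ => zero_le_one) one_ne_zero
    simpa using this
  have hF0 : F 0 < 0 := by
    have : F 0 = volume.real (simplex d) * (1 / ((d : ℝ) + 1) - b) := by
      simp only [hF, zero_mul, Real.exp_zero, mul_one]
      rw [integral_sub (integrableOn_simplex continuous_hat)
        (integrableOn_simplex continuous_const), setIntegral_hat]
      simp
      ring
    rw [this]
    exact mul_neg_of_pos_of_neg hvol (by linarith)
  set Q := ∫ t : Fin d → ℝ in simplex d, max (hat t - b) 0 ^ 2 with hQ
  -- Here `b < 1` is essential: `hat - b` is positive at the barycenter.
  have hQpos : 0 < Q := by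
    refine setIntegral_simplex_pos hpos (fun _ _ => sq_nonneg _) ?_
    rw [hat_center, max_eq_left (by linarith)]
    exact pow_ne_zero 2 (by linarith)
  -- The root of the affine minorant `F 0 + s * Q` of `F s`.
  set s₁ := -F 0 / Q with hs₁
  have hs₁pos : 0 < s₁ := div_pos (by linarith) hQpos
  have hF1 : 0 ≤ F s₁ := by
    have hle : ∫ t : Fin d → ℝ in simplex d, ((hat t - b) + s₁ * max (hat t - b) 0 ^ 2) ≤ F s₁ := by
      refine setIntegral_mono (integrableOn_simplex (hsub.add (continuous_const.mul hpos)))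
        (integrableOn_simplex (hsub.mul
          (Real.continuous_exp.comp (continuous_const.mul hsub)))) fun t => ?_
      exact add_mul_max_sq_le _ _ hs₁pos.le
    rw [integral_add (integrableOn_simplex hsub) ((integrableOn_simplex hpos).const_mul s₁),
      integral_const_mul, ← hQ] at hle
    have h0 : F 0 = ∫ t : Fin d → ℝ in simplex d, (hat t - b) := by simp [hF]
    rw [← h0, hs₁, div_mul_cancel₀ _ hQpos.ne'] at hle
    linarith
  obtain ⟨s, hs, hs0⟩ := intermediate_value_Icc hs₁pos.le hFc.continuousOn ⟨hF0.le, hF1⟩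
  refine ⟨s, lt_of_le_of_ne hs.1 ?_, hs0⟩
  rintro rfl
  exact hF0.ne hs0

/-- The parameters of the optimal density `exp (u + s * hat t)`. -/
lemma exists_optimal_parameters {b : ℝ} (hb : b < 1) :
    ∃ u s : ℝ, 0 ≤ s ∧ (0 < s ↔ 1 / ((d : ℝ) + 1) < b) ∧
      ∫ t : Fin d → ℝ in simplex d, Real.exp (u + s * hat t) = 1 ∧
      b ≤ ∫ t : Fin d → ℝ in simplex d, hat t * Real.exp (u + s * hat t) ∧
      s * ((∫ t : Fin d → ℝ in simplex d, hat t * Real.exp (u + s * hat t)) - b) = 0 := by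
  have key : ∀ s : ℝ, ∃ u : ℝ, ∫ t : Fin d → ℝ in simplex d, Real.exp (u + s * hat t) = 1 := by
    intro s
    have hI := setIntegral_simplex_pos (continuous_exp_hat (d := d) 0 s)
      (fun _ _ => (Real.exp_pos _).le) (Real.exp_pos _).ne'
    refine ⟨-Real.log (∫ t : Fin d → ℝ in simplex d, Real.exp (0 + s * hat t)), ?_⟩
    simp_rw [Real.exp_add, Real.exp_neg] at hI ⊢
    rw [integral_const_mul, Real.exp_log hI]
    simp only [Real.exp_zero, one_mul] at hI ⊢
    exact inv_mul_cancel₀ hI.ne'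
  rcases le_or_gt b (1 / ((d : ℝ) + 1)) with hle | hlt
  · obtain ⟨u, hu⟩ := key 0
    refine ⟨u, 0, le_rfl, by simpa using hle, hu, ?_, by ring⟩
    simp only [zero_mul, add_zero] at hu ⊢
    rw [integral_mul_const, setIntegral_hat]
    rw [setIntegral_const, smul_eq_mul] at hu
    rwa [div_mul_eq_mul_div, hu]
  · obtain ⟨s, hs, h0⟩ := exists_tilt_of_lt hb hlt
    obtain ⟨u, hu⟩ := key s
    have hp : (∫ t : Fin d → ℝ in simplex d, hat t * Real.exp (u + s * hat t)) - b = 0 := by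
      have h1 : ∫ t : Fin d → ℝ in simplex d, (hat t - b) * Real.exp (u + s * hat t) = 0 := by
        -- Normalizing and recentering the exponent only multiplies the integrand by a constant.
        have : ∀ t : Fin d → ℝ, (hat t - b) * Real.exp (u + s * hat t) =
            Real.exp (u + s * b) * ((hat t - b) * Real.exp (s * (hat t - b))) := by
          intro t
          rw [mul_left_comm, ← Real.exp_add]
          ring_nf
        simp_rw [this]
        rw [integral_const_mul, h0, mul_zero]
      simp_rw [sub_mul] at h1
      rwa [integral_sub (f := fun t => hat t * Real.exp (u + s * hat t))
        (integrableOn_simplex (by fun_prop))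
        ((integrableOn_simplex (continuous_exp_hat u s)).const_mul b),
        integral_const_mul, hu, mul_one] at h1
    exact ⟨u, s, hs.le, by simpa [hs] using hlt, hu, by linarith, by rw [hp, mul_zero]⟩

/-! ### The log-likelihood -/

lemma logLikelihood_of_pos {ι : Type*} [Fintype ι] {X : ι → Fin d → ℝ} (w : ι → ℝ)
    {f : (Fin d → ℝ) → ℝ} (hf : ∀ i, 0 < f (X i)) :
    logLikelihood X w f = ((∑ i, w i * Real.log (f (X i)) : ℝ) : EReal) := by
  simp_rw [logLikelihood, ENNReal.log_ofReal_of_pos (hf _), ← EReal.coe_mul]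
  exact (map_sum (⟨⟨Real.toEReal, EReal.coe_zero⟩, EReal.coe_add⟩ : ℝ →+ EReal) _ _).symm

lemma logLikelihood_eq_bot {ι : Type*} [Fintype ι] {X : ι → Fin d → ℝ} {w : ι → ℝ}
    {f : (Fin d → ℝ) → ℝ} {i : ι} (hw : 0 < w i) (hf : f (X i) ≤ 0) :
    logLikelihood X w f = ⊥ := by
  classical
  rw [logLikelihood, ← Finset.add_sum_erase _ _ (Finset.mem_univ i), ENNReal.log_ofReal,
    if_pos hf, EReal.coe_mul_bot_of_pos hw, EReal.bot_add]

lemma vertexMean_le_of_isLogConcaveDensity {g : (Fin d → ℝ) → ℝ} (hg : IsLogConcaveDensity g)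
    (hpos : ∀ k, 0 < g (specialConfig d k)) :
    vertexMean (fun k => Real.log (g (specialConfig d k))) ≤
      Real.log (g (specialConfig d (Fin.last (d + 1)))) := by
  have h := hg.logConcave.le_map_sum (t := Finset.univ)
    (w := fun _ : Fin (d + 1) => 1 / ((d : ℝ) + 1)) (p := vertex d)
    (fun _ _ => (one_div_pos.2 (succ_cast_pos d)).le) (by simp [(succ_cast_pos d).ne'])
    (fun i _ => by simpa [specialConfig_castSucc] using hpos i.castSucc)
  rw [← center_eq_sum, ← specialConfig_last] at h
  refine le_trans (le_of_eq ?_) h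
  simp only [vertexMean, specialConfig_castSucc, smul_eq_mul, ← Finset.mul_sum]
  ring

lemma exp_interp_le_of_isLogConcaveDensity {g : (Fin d → ℝ) → ℝ} (hg : IsLogConcaveDensity g)
    (hpos : ∀ k, 0 < g (specialConfig d k)) {t : Fin d → ℝ} (ht : t ∈ simplex d) :
    Real.exp (interp (fun k => Real.log (g (specialConfig d k))) t) ≤ g t := by
  have hmem : t ∈ {t | 0 < g t} := by
    rw [← sum_coneCoord_smul t]
    exact hg.logConcave.1.sum_mem (fun k _ => coneCoord_nonneg ht k) (sum_coneCoord t)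
      fun k _ => hpos k
  have h := hg.logConcave.le_map_sum (t := Finset.univ) (w := coneCoord t) (p := specialConfig d)
    (fun k _ => coneCoord_nonneg ht k) (sum_coneCoord t) (fun k _ => hpos k)
  simp only [smul_eq_mul] at h
  rw [sum_coneCoord_smul, sum_coneCoord_mul] at h
  exact (Real.le_log_iff_exp_le hmem).1 h

/-- Only an inequality survives: `g` may carry mass outside the simplex or exceed the interpolant
inside it. -/
lemma setIntegral_exp_interp_le_one {g : (Fin d → ℝ) → ℝ} (hg : IsLogConcaveDensity g)
    (hpos : ∀ k, 0 < g (specialConfig d k)) :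
    ∫ t in simplex d, Real.exp (interp (fun k => Real.log (g (specialConfig d k))) t) ≤ 1 := by
  calc _ ≤ ∫ t in simplex d, g t :=
        setIntegral_mono_on (integrableOn_simplex (by fun_prop)) hg.integrable.integrableOn
          measurableSet_simplex fun t ht => exp_interp_le_of_isLogConcaveDensity hg hpos ht
    _ ≤ ∫ t, g t := setIntegral_le_integral hg.integrable (.of_forall hg.nonneg)
    _ = 1 := hg.integral_eq_one

lemma tentDensity_specialConfig (hd : 1 ≤ d) {y : Fin (d + 2) → ℝ}
    (hy : vertexMean y ≤ y (Fin.last (d + 1))) (k : Fin (d + 2)) :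
    tentDensity (specialConfig d) y (specialConfig d k) = Real.exp (y k) := by
  rw [tentDensity_eq_indicator hd hy, Set.indicator_of_mem (specialConfig_mem_simplex k),
    interp_specialConfig hd]

lemma logLikelihood_tentDensity (hd : 1 ≤ d) (w : Fin (d + 2) → ℝ) {y : Fin (d + 2) → ℝ}
    (hy : vertexMean y ≤ y (Fin.last (d + 1))) :
    logLikelihood (specialConfig d) w (tentDensity (specialConfig d) y) =
      ((∑ k, w k * y k : ℝ) : EReal) := by
  rw [logLikelihood_of_pos w fun k => ?_]
  · simp [tentDensity_specialConfig hd hy]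
  · rw [tentDensity_specialConfig hd hy]
    exact Real.exp_pos _

lemma integral_tentDensity (hd : 1 ≤ d) {y : Fin (d + 2) → ℝ}
    (hy : vertexMean y ≤ y (Fin.last (d + 1))) :
    ∫ t, tentDensity (specialConfig d) y t = ∫ t in simplex d, Real.exp (interp y t) := by
  rw [tentDensity_eq_indicator hd hy, integral_indicator measurableSet_simplex]

lemma isLogConcaveDensity_tentDensity (hd : 1 ≤ d) {y : Fin (d + 2) → ℝ}
    (hy : vertexMean y ≤ y (Fin.last (d + 1)))
    (hint : ∫ t in simplex d, Real.exp (interp y t) = 1) :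
    IsLogConcaveDensity (tentDensity (specialConfig d) y) := by
  refine ⟨?_, ?_, ?_, (integral_tentDensity hd hy).trans hint⟩
  · rw [tentDensity_eq_indicator hd hy]
    exact fun t => Set.indicator_nonneg (fun _ _ => (Real.exp_pos _).le) t
  · have hsupp : {t | 0 < tentDensity (specialConfig d) y t} = simplex d := by
      ext t
      by_cases ht : t ∈ simplex d <;>
        simp [tentDensity_eq_indicator hd hy, ht, Real.exp_pos]
    rw [hsupp]
    refine ((concaveOn_interp hy).subset (Set.subset_univ _) convex_simplex).congr fun t ht => ?_
    simp [tentDensity_eq_indicator hd hy, ht]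
  · rw [tentDensity_eq_indicator hd hy, integrable_indicator_iff measurableSet_simplex]
    exact integrableOn_simplex (by fun_prop)

/-! ### Symmetric heights and optimality -/

/-- The heights equal to `u` at the vertices and to `u + s` at the barycenter. -/
def symmHeights (d : ℕ) (u s : ℝ) : Fin (d + 2) → ℝ :=
  Fin.snoc (α := fun _ => ℝ) (fun _ : Fin (d + 1) => u) (u + s)

@[simp] lemma symmHeights_castSucc (u s : ℝ) (i : Fin (d + 1)) :
    symmHeights d u s i.castSucc = u := by simp [symmHeights]

@[simp] lemma symmHeights_last (u s : ℝ) :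
    symmHeights d u s (Fin.last (d + 1)) = u + s := by simp [symmHeights]

@[simp] lemma vertexMean_symmHeights (u s : ℝ) : vertexMean (symmHeights d u s) = u := by
  have := (succ_cast_pos d).ne'
  simp [vertexMean]
  field_simp

lemma interp_symmHeights (u s : ℝ) (t : Fin d → ℝ) :
    interp (symmHeights d u s) t = u + s * hat t := by
  simp [interp, ← Finset.sum_mul, sum_bary]
  ring

/-- By symmetry each barycentric coordinate has mean `1 / (d + 1)` under the density, so the linear
part of `interp z` contributes the vertex mean. -/
lemma setIntegral_interp_mul {u s : ℝ}
    (hint : ∫ t : Fin d → ℝ in simplex d, Real.exp (u + s * hat t) = 1) (z : Fin (d + 2) → ℝ) :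
    ∫ t in simplex d, interp z t * Real.exp (u + s * hat t) =
      vertexMean z + (∫ t : Fin d → ℝ in simplex d, hat t * Real.exp (u + s * hat t)) *
        (z (Fin.last (d + 1)) - vertexMean z) := by
  have hexp : ∀ t : Fin d → ℝ, interp z t * Real.exp (u + s * hat t) =
      ∑ i : Fin (d + 1), z i.castSucc * (bary i t * Real.exp (u + s * hat t)) +
        hat t * Real.exp (u + s * hat t) * (z (Fin.last (d + 1)) - vertexMean z) := by
    intro t
    rw [interp, add_mul, Finset.sum_mul]
    congr 1
    · exact Finset.sum_congr rfl fun i _ => by ring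
    · ring
  simp_rw [hexp]
  rw [integral_add, integral_mul_const, integral_finsetSum]
  · congr 1
    simp_rw [integral_const_mul]
    have hb : ∀ i : Fin (d + 1), ∫ t in simplex d, bary i t * Real.exp (u + s * hat t) =
        1 / ((d : ℝ) + 1) := fun i => by
      rw [setIntegral_bary_mul i (φ := fun x => Real.exp (u + s * x)) (by fun_prop), hint]
    simp_rw [hb, ← Finset.sum_mul]
    rw [vertexMean]
    ring
  all_goals first
    | exact fun i _ => integrableOn_simplex (by fun_prop)
    | exact integrableOn_simplex (by fun_prop)

lemma weights_eq {w : Fin (d + 2) → ℝ} (hsum : ∑ i, w i = 1)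
    (heq : ∀ i : Fin (d + 1), w i.castSucc = w 0) :
    ((d : ℝ) + 1) * w 0 + w (Fin.last (d + 1)) = 1 := by
  rw [Fin.sum_univ_castSucc (n := d + 1)] at hsum
  simpa [heq] using hsum

lemma sum_weights_mul {w : Fin (d + 2) → ℝ} (hsum : ∑ i, w i = 1)
    (heq : ∀ i : Fin (d + 1), w i.castSucc = w 0) (z : Fin (d + 2) → ℝ) :
    ∑ k, w k * z k =
      vertexMean z + w (Fin.last (d + 1)) * (z (Fin.last (d + 1)) - vertexMean z) := by
  have hd := (succ_cast_pos d).ne'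
  have hw := weights_eq hsum heq
  rw [Fin.sum_univ_castSucc (n := d + 1)]
  simp_rw [heq, ← Finset.mul_sum]
  have hz : ∑ i : Fin (d + 1), z i.castSucc = ((d : ℝ) + 1) * vertexMean z := by
    rw [vertexMean, mul_div_cancel₀ _ hd]
  rw [hz]
  linear_combination vertexMean z * hw

/-- `symmHeights d u s` strictly maximizes the linear functional given by the weights among all
heights of concave interpolants whose exponential has integral at most one. -/
lemma symmHeights_maximal (hd : 1 ≤ d) {w : Fin (d + 2) → ℝ} (hsum : ∑ i, w i = 1)
    (heq : ∀ i : Fin (d + 1), w i.castSucc = w 0) {u s : ℝ}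
    (hint : ∫ t : Fin d → ℝ in simplex d, Real.exp (u + s * hat t) = 1)
    (hle : w (Fin.last (d + 1)) ≤
      ∫ t : Fin d → ℝ in simplex d, hat t * Real.exp (u + s * hat t))
    (hslack : s * ((∫ t : Fin d → ℝ in simplex d, hat t * Real.exp (u + s * hat t)) -
      w (Fin.last (d + 1))) = 0)
    {z : Fin (d + 2) → ℝ} (hz : vertexMean z ≤ z (Fin.last (d + 1)))
    (hzint : ∫ t in simplex d, Real.exp (interp z t) ≤ 1) :
    ∑ k, w k * z k ≤ ∑ k, w k * symmHeights d u s k ∧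
      (∑ k, w k * z k = ∑ k, w k * symmHeights d u s k → z = symmHeights d u s) := by
  set p := ∫ t : Fin d → ℝ in simplex d, hat t * Real.exp (u + s * hat t) with hp
  -- The gap between `exp` and its tangent line at `u + s * hat t`, evaluated at `interp z t`;
  -- nonnegative by convexity.
  set G : (Fin d → ℝ) → ℝ := fun t => Real.exp (interp z t) - Real.exp (u + s * hat t) -
    interp z t * Real.exp (u + s * hat t) +
      interp (symmHeights d u s) t * Real.exp (u + s * hat t) with hG
  have hGc : Continuous G := by fun_prop
  have hGeq : ∀ t, G t = Real.exp (u + s * hat t) *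
      (Real.exp (interp z t - (u + s * hat t)) - ((interp z t - (u + s * hat t)) + 1)) := by
    intro t
    have : Real.exp (interp z t) =
        Real.exp (u + s * hat t) * Real.exp (interp z t - (u + s * hat t)) := by
      rw [← Real.exp_add]; ring_nf
    simp only [hG, interp_symmHeights]
    rw [this]
    ring
  have hGnn : ∀ t ∈ simplex d, 0 ≤ G t := fun t _ => by
    rw [hGeq]
    exact mul_nonneg (Real.exp_pos _).le (sub_nonneg.2 (Real.add_one_le_exp _))
  have hGint : ∫ t in simplex d, G t = (∫ t in simplex d, Real.exp (interp z t)) - 1 -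
      (vertexMean z + p * (z (Fin.last (d + 1)) - vertexMean z)) + (u + p * s) := by
    have hself := setIntegral_interp_mul hint (symmHeights d u s)
    rw [vertexMean_symmHeights, symmHeights_last, add_sub_cancel_left] at hself
    rw [← setIntegral_interp_mul hint z, ← hself, ← hint, hG, integral_add, integral_sub,
      integral_sub]
    all_goals exact integrableOn_simplex (by fun_prop)
  have hGint0 : 0 ≤ ∫ t in simplex d, G t :=
    setIntegral_nonneg measurableSet_simplex hGnn
  rw [sum_weights_mul hsum heq, sum_weights_mul hsum heq, vertexMean_symmHeights,
    symmHeights_last, add_sub_cancel_left]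
  -- Concavity of the competitor makes its elevation nonnegative, so `b ≤ p` suffices; for the
  -- candidate, complementary slackness gives equality.
  have hmono := mul_le_mul_of_nonneg_right hle (sub_nonneg.2 hz)
  have hs : p * s = w (Fin.last (d + 1)) * s := by linear_combination hslack
  refine ⟨by linarith, fun h => ?_⟩
  -- Equal objectives leave no slack in the chain of inequalities, so the nonnegative gap integrates
  -- to zero.
  have hzero : ∫ t in simplex d, G t = 0 := by linarith
  have hG0 := eqOn_zero_of_setIntegral_eq_zero hGc hGnn hzero
  funext k
  have h0 := hG0 (specialConfig_mem_simplex k)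
  rw [Pi.zero_apply, hGeq, mul_eq_zero, or_iff_right (Real.exp_pos _).ne',
    ← interp_symmHeights, interp_specialConfig hd, interp_specialConfig hd] at h0
  by_contra hne
  have := Real.add_one_lt_exp (sub_ne_zero.2 hne)
  linarith

/-- A competitor positive at all sample points is replaced by the heights `log g`; one vanishing at
a sample point has log-likelihood `⊥`, since all weights are positive. -/
lemma isOptimalHeights_iff (hd : 1 ≤ d) {w : Fin (d + 2) → ℝ} (hpos : ∀ i, 0 < w i)
    (hsum : ∑ i, w i = 1) (heq : ∀ i : Fin (d + 1), w i.castSucc = w 0) {u s : ℝ} (hs : 0 ≤ s)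
    (hint : ∫ t : Fin d → ℝ in simplex d, Real.exp (u + s * hat t) = 1)
    (hle : w (Fin.last (d + 1)) ≤
      ∫ t : Fin d → ℝ in simplex d, hat t * Real.exp (u + s * hat t))
    (hslack : s * ((∫ t : Fin d → ℝ in simplex d, hat t * Real.exp (u + s * hat t)) -
      w (Fin.last (d + 1))) = 0) (y : Fin (d + 2) → ℝ) :
    IsOptimalHeights (specialConfig d) w y ↔ y = symmHeights d u s := by
  have hmean : vertexMean (symmHeights d u s) ≤ symmHeights d u s (Fin.last (d + 1)) := by
    simpa using hs
  have hdens : IsLogConcaveDensity (tentDensity (specialConfig d) (symmHeights d u s)) :=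
    isLogConcaveDensity_tentDensity hd hmean (by simpa only [interp_symmHeights] using hint)
  have hmax : ∀ z : Fin (d + 2) → ℝ, vertexMean z ≤ z (Fin.last (d + 1)) →
      ∫ t in simplex d, Real.exp (interp z t) ≤ 1 → _ := fun z hz hzint =>
    symmHeights_maximal hd hsum heq hint hle hslack hz hzint
  constructor
  · rintro ⟨hrel, hmle⟩
    have hy := (isRelevant_iff hd).1 hrel
    have hyint : ∫ t in simplex d, Real.exp (interp y t) ≤ 1 :=
      ((integral_tentDensity hd hy).symm.trans hmle.1.integral_eq_one).le
    have hcomp := hmle.2 _ hdens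
    rw [logLikelihood_tentDensity hd w hmean, logLikelihood_tentDensity hd w hy,
      EReal.coe_le_coe_iff] at hcomp
    exact (hmax y hy hyint).2 (le_antisymm (hmax y hy hyint).1 hcomp)
  · rintro rfl
    refine ⟨(isRelevant_iff hd).2 hmean, hdens, fun g hg => ?_⟩
    by_cases hgpos : ∀ k, 0 < g (specialConfig d k)
    · rw [logLikelihood_tentDensity hd w hmean, logLikelihood_of_pos w hgpos,
        EReal.coe_le_coe_iff]
      exact (hmax _ (vertexMean_le_of_isLogConcaveDensity hg hgpos)
        (setIntegral_exp_interp_le_one hg hgpos)).1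
    · push Not at hgpos
      obtain ⟨k, hk⟩ := hgpos
      rw [logLikelihood_eq_bot (hpos k) hk]
      exact bot_le

/-! ### The induced subdivision -/

lemma tent_symmHeights (hd : 1 ≤ d) {u s : ℝ} (hs : 0 ≤ s) {t : Fin d → ℝ}
    (ht : t ∈ simplex d) :
    tent (specialConfig d) (symmHeights d u s) t = u + s * hat t := by
  rw [tent_eq_interp hd (by simpa using hs) ht, interp_symmHeights]

lemma univ_mem_regularSubdivision (hd : 1 ≤ d) (u : ℝ) :
    Set.univ ∈ regularSubdivision (specialConfig d) (symmHeights d u 0) := by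
  have hrel : IsRelevant (specialConfig d) (symmHeights d u 0) := (isRelevant_iff hd).2 (by simp)
  have htent : ∀ t ∈ simplex d, tent (specialConfig d) (symmHeights d u 0) t = u :=
    fun t ht => by simpa using tent_symmHeights hd le_rfl (u := u) ht
  have hR : {t | t ∈ polytope (specialConfig d) ∧ tent (specialConfig d) (symmHeights d u 0) t =
      AffineMap.const ℝ (Fin d → ℝ) u t} = simplex d := by
    ext t
    rw [polytope_specialConfig]
    exact ⟨fun h => h.1, fun h => ⟨h, by simpa using htent t h⟩⟩
  refine ⟨simplex d, ⟨AffineMap.const ℝ _ u, hR.symm, center d, center_mem_interior⟩, ?_⟩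
  exact (Set.eq_univ_iff_forall.2 fun k => And.intro (specialConfig_mem_simplex k) (hrel k)).symm

lemma univ_notMem_interiorTriangulation : Set.univ ∉ interiorTriangulation d := by
  rintro ⟨i, hi⟩
  exact Set.eq_univ_iff_forall.1 hi i.castSucc rfl

/-- Moving away from vertex `i` makes the `i`-th barycentric coordinate the strict minimum. -/
lemma bary_sub_lt {t : Fin d → ℝ} {i : Fin (d + 1)} (h : ∀ j, bary i t ≤ bary j t) {ε : ℝ}
    (hε : 0 < ε) {j : Fin (d + 1)} (hj : j ≠ i) :
    bary i (t + ε • (center d - vertex d i)) < bary j (t + ε • (center d - vertex d i)) := by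
  have hcalc : ∀ k : Fin (d + 1), bary k (t + ε • (center d - vertex d i)) =
      bary k t + ε * (bary k (center d) - bary k (vertex d i)) := by
    intro k
    have h1 := (bary k).map_vadd t (ε • (center d - vertex d i))
    have h2 := (bary k).linearMap_vsub (center d) (vertex d i)
    simp only [vadd_eq_add, vsub_eq_sub, map_smul, smul_eq_mul] at h1 h2
    rw [add_comm, h1, h2]
    ring
  rw [hcalc, hcalc, bary_center, bary_center, bary_vertex, bary_vertex, if_pos rfl, if_neg hj]
  nlinarith [h j]

/-- The affine function with which the symmetric tent agrees on the cone over the facet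
opposite to vertex `i`. -/
def facetMap (d : ℕ) (u s : ℝ) (i : Fin (d + 1)) : (Fin d → ℝ) →ᵃ[ℝ] ℝ :=
  AffineMap.const ℝ _ u + (s * ((d : ℝ) + 1)) • bary i

lemma facetMap_apply (u s : ℝ) (i : Fin (d + 1)) (t : Fin d → ℝ) :
    facetMap d u s i t = u + s * (((d : ℝ) + 1) * bary i t) := by
  simp [facetMap, mul_assoc]

lemma isOpen_strictMin (i : Fin (d + 1)) :
    IsOpen {t : Fin d → ℝ | ∀ j, j ≠ i → bary i t < bary j t} := by
  simp only [Set.ofPred_forall]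
  exact isOpen_iInter_of_finite fun j => isOpen_iInter_of_finite fun _ =>
    isOpen_lt (continuous_bary i) (continuous_bary j)

lemma hat_eq_of_strictMin {t : Fin d → ℝ} {i : Fin (d + 1)}
    (h : ∀ j, j ≠ i → bary i t < bary j t) : hat t = ((d : ℝ) + 1) * bary i t :=
  hat_eq_of_forall i fun j => by
    by_cases hj : j = i
    · rw [hj]
    · exact (h j hj).le

/-- A small push away from vertex `i` breaks ties, so every nonempty open set meets the interior of
one of the cones where `hat` is affine. -/
lemma exists_strictMin_mem {U : Set (Fin d → ℝ)} (hU : IsOpen U) {t : Fin d → ℝ} (ht : t ∈ U)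
    {i : Fin (d + 1)} (h : ∀ j, bary i t ≤ bary j t) :
    ∃ t' ∈ U, ∀ j, j ≠ i → bary i t' < bary j t' := by
  have hc : Continuous fun ε : ℝ => t + ε • (center d - vertex d i) := by fun_prop
  have hmem : ∀ᶠ ε in nhdsWithin (0 : ℝ) (Set.Ioi 0), t + ε • (center d - vertex d i) ∈ U :=
    (hc.continuousAt.eventually (hU.mem_nhds (by simpa using ht))).filter_mono nhdsWithin_le_nhds
  obtain ⟨ε, hεU, hε⟩ := (hmem.and self_mem_nhdsWithin).exists
  exact ⟨_, hεU, fun j hj => bary_sub_lt h hε hj⟩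

/-- Since `s ≠ 0`, membership means that coordinate `i` attains the minimum defining `hat`. This
holds at the barycenter and at every vertex but the `i`-th. -/
lemma setOf_specialConfig_mem_facet (hd : 1 ≤ d) {u s : ℝ} (hs : 0 < s) (i : Fin (d + 1)) :
    {k | specialConfig d k ∈ {t | t ∈ polytope (specialConfig d) ∧
        tent (specialConfig d) (symmHeights d u s) t = facetMap d u s i t} ∧
      tent (specialConfig d) (symmHeights d u s) (specialConfig d k) = symmHeights d u s k} =
      {i.castSucc}ᶜ := by
  have hrel : IsRelevant (specialConfig d) (symmHeights d u s) :=
    (isRelevant_iff hd).2 (by simpa using hs.le)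
  ext k
  have hk : (k ∈ {k | specialConfig d k ∈ {t | t ∈ polytope (specialConfig d) ∧
        tent (specialConfig d) (symmHeights d u s) t = facetMap d u s i t} ∧
      tent (specialConfig d) (symmHeights d u s) (specialConfig d k) = symmHeights d u s k}) ↔
      hat (specialConfig d k) = ((d : ℝ) + 1) * bary i (specialConfig d k) := by
    simp only [Set.mem_ofPred_eq, polytope_specialConfig, specialConfig_mem_simplex, true_and,
      hrel k, and_true]
    rw [← hrel k, tent_symmHeights hd hs.le (specialConfig_mem_simplex k), facetMap_apply,
      add_right_inj, mul_right_inj' hs.ne']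
  rw [hk, Set.mem_compl_iff, Set.mem_singleton_iff]
  refine Fin.lastCases ?_ (fun j => ?_) k
  · rw [specialConfig_last, hat_center, bary_center, mul_one_div_cancel (succ_cast_pos d).ne']
    simpa using (Fin.castSucc_ne_last i).symm
  · rw [specialConfig_castSucc, hat_vertex hd, bary_vertex, Fin.castSucc_inj]
    by_cases hij : i = j
    · simp [hij, (succ_cast_pos d).ne]
    · simp [hij, Ne.symm hij]

lemma regularSubdivision_symmHeights (hd : 1 ≤ d) {u s : ℝ} (hs : 0 < s) :
    regularSubdivision (specialConfig d) (symmHeights d u s) = interiorTriangulation d := by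
  ext σ
  constructor
  · rintro ⟨R, ⟨l, rfl, t, ht⟩, rfl⟩
    set R := {t | t ∈ polytope (specialConfig d) ∧
      tent (specialConfig d) (symmHeights d u s) t = l t} with hR
    obtain ⟨i, -, hi⟩ := Finset.exists_min_image Finset.univ (fun i : Fin (d + 1) => bary i t)
      Finset.univ_nonempty
    obtain ⟨t', ht'R, ht'⟩ := exists_strictMin_mem isOpen_interior ht
      fun j => hi j (Finset.mem_univ j)
    have hopen : IsOpen (interior R ∩ {t : Fin d → ℝ | ∀ j, j ≠ i → bary i t < bary j t}) :=
      isOpen_interior.inter (isOpen_strictMin i)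
    -- Two affine maps agreeing on a nonempty open set coincide.
    have hl : l = facetMap d u s i := by
      refine AffineMap.ext_on (hopen.affineSpan_eq_top ⟨t', ht'R, ht'⟩) fun x hx => ?_
      have hxR := interior_subset hx.1
      have hxS : x ∈ simplex d := polytope_specialConfig ▸ hxR.1
      rw [← hxR.2, tent_symmHeights hd hs.le hxS, facetMap_apply, hat_eq_of_strictMin hx.2]
    refine ⟨i, ?_⟩
    rw [hR, hl]
    exact (setOf_specialConfig_mem_facet hd hs i).symm
  · rintro ⟨i, rfl⟩
    refine ⟨_, ⟨facetMap d u s i, rfl, ?_⟩, (setOf_specialConfig_mem_facet hd hs i).symm⟩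
    obtain ⟨t, htS, ht⟩ := exists_strictMin_mem isOpen_interior (center_mem_interior (d := d))
      (i := i) (by simp)
    refine ⟨t, mem_interior.2 ⟨_, fun x hx => ?_,
      isOpen_interior.inter (isOpen_strictMin i), htS, ht⟩⟩
    have hxS : x ∈ simplex d := interior_subset hx.1
    refine ⟨polytope_specialConfig ▸ hxS, ?_⟩
    rw [tent_symmHeights hd hs.le hxS, facetMap_apply, hat_eq_of_strictMin hx.2]

end

end LogConcaveMLE

theorem corollary5p5 (d : ℕ) (hd : 1 ≤ d) (w : Fin (d + 2) → ℝ)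
    (hpos : ∀ i, 0 < w i) (hsum : ∑ i, w i = 1)
    (heq : ∀ i : Fin (d + 1), w i.castSucc = w 0) :
    (∃! y : Fin (d + 2) → ℝ,
      LogConcaveMLE.IsOptimalHeights (LogConcaveMLE.specialConfig d) w y) ∧
    (((d : ℝ) + 1) / (d : ℝ) < w (Fin.last (d + 1)) / w 0 ↔
      LogConcaveMLE.IsOptimalSubdivision (LogConcaveMLE.specialConfig d) w
        (LogConcaveMLE.interiorTriangulation d)) := by
  have hw := LogConcaveMLE.weights_eq hsum heq
  have hd0 : (0 : ℝ) < d := by exact_mod_cast hd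
  have hb : w (Fin.last (d + 1)) < 1 := by
    have := mul_pos (LogConcaveMLE.succ_cast_pos d) (hpos 0)
    linarith
  obtain ⟨u, s, hs, hspos, hint, hle, hslack⟩ :=
    LogConcaveMLE.exists_optimal_parameters (d := d) hb
  have hopt := LogConcaveMLE.isOptimalHeights_iff hd hpos hsum heq hs hint hle hslack
  -- Eliminating `w 0` through `hw` turns the ratio condition into `1 / (d + 1) < w (Fin.last (d +
  -- 1))`.
  have hthreshold : ((d : ℝ) + 1) / (d : ℝ) < w (Fin.last (d + 1)) / w 0 ↔ 0 < s := by
    rw [hspos, div_lt_div_iff₀ hd0 (hpos 0), div_lt_iff₀ (LogConcaveMLE.succ_cast_pos d)]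
    constructor <;> intro h <;> linarith
  refine ⟨⟨_, (hopt _).2 rfl, fun y hy => (hopt y).1 hy⟩, hthreshold.trans ⟨fun h => ?_, ?_⟩⟩
  · exact ⟨_, (hopt _).2 rfl, LogConcaveMLE.regularSubdivision_symmHeights hd h⟩
  · rintro ⟨y, hy, hsub⟩
    obtain rfl := (hopt y).1 hy
    -- If `s = 0`, the tent is flat and all labels form a single cell, which the triangulation does
    -- not contain.
    refine hs.lt_of_ne ?_
    rintro rfl
    exact LogConcaveMLE.univ_notMem_interiorTriangulation
      (hsub ▸ LogConcaveMLE.univ_mem_regularSubdivision hd u)
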